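/- Let $F = F(X)$ be the free group on a finite or effectively encoded countable alphabet $X$, let $N$ be a normal subgroup of $F$, and let $N' = [N,N]$ be its derived subgroup. Assume that $N$ is recursively enumerable, that is, the set of words in the letters $X \cup X^{-1}$ that represent elements of $N$ is recursively enumerable. If the conjugacy problem in $F/N'$ is decidable (there is an algorithm which, given words $u,v$ in $X \cup X^{-1}$, decides whether $u$ and $v$ represent conjugate elements of $F/N'$), then the power problem in $F/N$ is decidable (there is an algorithm which, given words $u,v$ in $X \cup X^{-1}$, decides whether $v = u^k$ in $F/N$ for some $k \in \mathbb{Z}$). -/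

import Mathlib

/-- Group words over the alphabet `α`: finite sequences of letters `(x, true)` (standing for `x`)
and `(x, false)` (standing for `x⁻¹`). Words need not be reduced. -/
abbrev GroupWord (α : Type*) : Type _ := List (α × Bool)

/-- The element of `F(α) / M` represented by a word. -/
def GroupWord.eval {α : Type*} (M : Subgroup (FreeGroup α)) (w : GroupWord α) :
    FreeGroup α ⧸ M :=
  QuotientGroup.mk (FreeGroup.mk w)

/-- A subgroup `N` of the free group `F(α)` is recursively enumerable if the set of all words that
represent elements of `N` is recursively enumerable. -/
def IsRecursivelyEnumerable {α : Type*} [Primcodable α] (N : Subgroup (FreeGroup α)) : Prop :=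
  REPred fun w : GroupWord α => FreeGroup.mk w ∈ N

/-- The conjugacy problem in `F(α) / M` is decidable: some algorithm decides, given words `u, v`,
whether they represent conjugate elements of `F(α) / M`. -/
def ConjugacyProblemDecidable {α : Type*} [Primcodable α]
    (M : Subgroup (FreeGroup α)) [M.Normal] : Prop :=
  ComputablePred fun p : GroupWord α × GroupWord α => IsConj (p.1.eval M) (p.2.eval M)

/-- The power problem in `F(α) / M` is decidable: some algorithm decides, given words `u, v`,
whether `v = u ^ k` in `F(α) / M` for some integer `k`. -/
def PowerProblemDecidable {α : Type*} [Primcodable α]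
    (M : Subgroup (FreeGroup α)) [M.Normal] : Prop :=
  ComputablePred fun p : GroupWord α × GroupWord α => ∃ k : ℤ, p.2.eval M = p.1.eval M ^ k

/-! Powers modulo `N` can be listed because `N` is r.e.; the task is to list the pairs where `v` is
not a power of `u`. If `F` is noncommutative and `N ≠ ⊥`, search for `n ∈ N` such that `⁅⁅u, v⁆, n⁆
∉ N'` or `⁅n, v⁆ * u` is not conjugate to `u` modulo `N'`. No such `n` exists when `v = u ^ k`
modulo `N` (`commutator_commutator_mem`, `isConj_commutator_mul`): `N / N'` is a module over `ℤ[F /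
N]`, where `1 - u` divides `1 - u ^ k`.

Conversely (`exists_not_isConj`), view `K / [K, K]` as the first homology of the coset graph of `K`,
through flows of closed paths. If `u` and `v` commute modulo `N`, let `K` and `L` be the preimages
of `⟨u⟩` and `⟨u, v⟩`. Comparing translated squares in a coset graph gives `n ∈ [L, L]` with `a =
⁅n, v⁆ ∉ [K, K]`. If all `⁅n ^ j, v⁆ * u` were conjugate to `u`, the flows of `a ^ j * u`, unbounded
in `j`, would all be translates of the flow of `u`. If `u` and `v` do not commute modulo `N`,
squares give `⁅⁅u, v⁆, n⁆ ∉ N'`.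

For `N = ⊥` common roots in free groups suffice; for cyclic `F` and `N ≠ ⊥` the quotient is finite.
-/

open scoped commutatorElement

/-! ### Closure properties of recursively enumerable predicates -/

section REPred

variable {β γ : Type*} [Primcodable β] [Primcodable γ]

theorem REPred.comp {p : γ → Prop} (hp : REPred p) {f : β → γ} (hf : Computable f) :
    REPred fun b => p (f b) :=
  Partrec.comp hp hf

theorem REPred.and {p q : β → Prop} (hp : REPred p) (hq : REPred q) :
    REPred fun b => p b ∧ q b :=
  (Partrec.bind hp (hq.comp Computable.fst).to₂).of_eq fun b => by
    ext; simp

theorem REPred.or {p q : β → Prop} (hp : REPred p) (hq : REPred q) :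
    REPred fun b => p b ∨ q b := by
  obtain ⟨k, hk, h⟩ := Partrec.merge hp hq fun _ _ _ _ _ => rfl
  exact hk.of_eq fun b => Part.ext fun x => by simp [h]

/-- The projection of a recursively enumerable relation is recursively enumerable. -/
theorem REPred.exists {p : β → γ → Prop} (hp : REPred fun x : β × γ => p x.1 x.2) :
    REPred fun b => ∃ c, p b c := by
  obtain ⟨e, he⟩ := Nat.Partrec.Code.exists_code.1 hp
  -- Dovetailing: `n` codes a number of steps together with a candidate witness.
  let g : β → ℕ → Option ℕ := fun b n =>
    (Encodable.decode (α := γ) n.unpair.2).bind fun c => e.evaln n.unpair.1 (Encodable.encode (b, c))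
  have hg : Computable₂ g := by
    refine Primrec.to_comp ?_
    refine Primrec.option_bind (Primrec.decode.comp <| Primrec.snd.comp <|
      Primrec.unpair.comp Primrec.snd) ?_
    refine Primrec.comp (g := fun x : (β × ℕ) × γ =>
      ((x.1.2.unpair.1, e), Encodable.encode (x.1.1, x.2))) Nat.Partrec.Code.primrec_evaln ?_
    refine Primrec.pair (Primrec.pair ?_ (Primrec.const e)) ?_
    · exact Primrec.fst.comp <| Primrec.unpair.comp <| Primrec.snd.comp Primrec.fst
    · exact Primrec.encode.comp <| Primrec.pair (Primrec.fst.comp Primrec.fst) Primrec.snd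
  have key : ∀ b c, p b c ↔ ∃ k x, x ∈ e.evaln k (Encodable.encode (b, c)) := by
    intro b c
    have h : p b c ↔ ∃ x, x ∈ e.eval (Encodable.encode (b, c)) := by
      rw [he]; simp
    rw [h]
    simp only [Nat.Partrec.Code.evaln_complete]
    exact exists_comm
  refine (Partrec.rfindOpt hg).dom_re.of_eq fun b => ?_
  rw [Nat.rfindOpt_dom]
  simp only [key, g]
  constructor
  · rintro ⟨n, a, h⟩
    obtain ⟨c, -, h⟩ := Option.bind_eq_some_iff.1 h
    exact ⟨c, _, a, h⟩
  · rintro ⟨c, k, x, h⟩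
    exact ⟨Nat.pair k (Encodable.encode c), x, by simpa using h⟩

/-- Nonuniform: `ι` carries no coding, so the disjunction is built up along an enumeration of `ι`.
-/
theorem REPred.exists_of_finite {ι : Type*} [Finite ι] {p : ι → β → Prop}
    (hp : ∀ i, REPred (p i)) : REPred fun b => ∃ i, p i b := by
  obtain ⟨n, ⟨e⟩⟩ := Finite.exists_equiv_fin ι
  have : ∀ m : ℕ, REPred fun b => ∃ i, (e i : ℕ) < m ∧ p i b := by
    intro m
    induction m with
    | zero =>
      refine REPred.of_eq (p := fun _ => False) ?_ (by simp)
      exact Partrec.none.of_eq fun b => by ext; simp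
    | succ m ih =>
      by_cases hm : m < n
      · refine (ih.or (hp (e.symm ⟨m, hm⟩))).of_eq fun b => ?_
        constructor
        · rintro (⟨i, hi, h⟩ | h)
          · exact ⟨i, by lia, h⟩
          · exact ⟨_, by simp, h⟩
        · rintro ⟨i, hi, h⟩
          rcases Nat.lt_succ_iff_lt_or_eq.1 hi with hi | rfl
          · exact .inl ⟨i, hi, h⟩
          · exact .inr (by simpa using h)
      · exact ih.of_eq fun b => exists_congr fun i => by
          have := (e i).2
          constructor <;> rintro ⟨h, h'⟩ <;> exact ⟨by lia, h'⟩
  exact (this n).of_eq fun b => exists_congr fun i => by simp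

end REPred

/-! ### Computable operations on words -/

namespace GroupWord

variable {α : Type*}

/-- The word `w ^ k.1 * w ^ (-k.2)`. -/
def powSub (w : GroupWord α) (k : ℕ × ℕ) : GroupWord α :=
  (w ++ ·)^[k.1] ((FreeGroup.invRev w ++ ·)^[k.2] [])

/-- The commutator of two words. -/
def comm (v w : GroupWord α) : GroupWord α :=
  v ++ w ++ FreeGroup.invRev v ++ FreeGroup.invRev w

theorem mk_append (v w : GroupWord α) :
    FreeGroup.mk (v ++ w) = FreeGroup.mk v * FreeGroup.mk w := rfl

theorem mk_invRev (w : GroupWord α) :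
    FreeGroup.mk (FreeGroup.invRev w) = (FreeGroup.mk w)⁻¹ := rfl

theorem mk_comm (v w : GroupWord α) :
    FreeGroup.mk (comm v w) = ⁅FreeGroup.mk v, FreeGroup.mk w⁆ := rfl

theorem mk_iterate (v w : GroupWord α) (n : ℕ) :
    FreeGroup.mk ((v ++ ·)^[n] w) = FreeGroup.mk v ^ n * FreeGroup.mk w := by
  induction n with
  | zero => simp
  | succ n ih => rw [Function.iterate_succ_apply', mk_append, ih, pow_succ', mul_assoc]

theorem mk_powSub (w : GroupWord α) (k : ℕ × ℕ) :
    FreeGroup.mk (powSub w k) = FreeGroup.mk w ^ ((k.1 : ℤ) - k.2) := by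
  rw [powSub, mk_iterate, mk_iterate, mk_invRev, zpow_sub, zpow_natCast, zpow_natCast, inv_pow,
    ← FreeGroup.one_eq_mk, mul_one]

variable [Primcodable α]

theorem computable_append {β : Type*} [Primcodable β] {f g : β → GroupWord α}
    (hf : Computable f) (hg : Computable g) : Computable fun b => f b ++ g b :=
  Primrec.list_append.to_comp.comp hf hg

theorem primrec_invRev : Primrec (FreeGroup.invRev : GroupWord α → GroupWord α) :=
  Primrec.list_reverse.comp <| Primrec.list_map Primrec.id <|
    (Primrec.pair (Primrec.fst.comp Primrec.snd)
      (Primrec.not.comp (Primrec.snd.comp Primrec.snd))).to₂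

theorem computable_invRev {β : Type*} [Primcodable β] {f : β → GroupWord α}
    (hf : Computable f) : Computable fun b => FreeGroup.invRev (f b) :=
  primrec_invRev.to_comp.comp hf

theorem computable_comm {β : Type*} [Primcodable β] {f g : β → GroupWord α}
    (hf : Computable f) (hg : Computable g) : Computable fun b => comm (f b) (g b) :=
  computable_append (computable_append (computable_append hf hg) (computable_invRev hf))
    (computable_invRev hg)

theorem computable_powSub {β : Type*} [Primcodable β] {f : β → GroupWord α} {g : β → ℕ × ℕ}
    (hf : Computable f) (hg : Computable g) : Computable fun b => powSub (f b) (g b) := by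
  have : Primrec₂ (powSub : GroupWord α → ℕ × ℕ → GroupWord α) := by
    refine Primrec.nat_iterate (Primrec.fst.comp Primrec.snd)
      (Primrec.nat_iterate (Primrec.snd.comp Primrec.snd) (Primrec.const []) ?_) ?_
    · exact Primrec.list_append.comp (primrec_invRev.comp (Primrec.fst.comp Primrec.fst))
        Primrec.snd
    · exact Primrec.list_append.comp (Primrec.fst.comp Primrec.fst) Primrec.snd
  exact this.to_comp.comp hf hg

end GroupWord

/-! ### The power problem expressed in the free group -/

section Problems

variable {α : Type*}

theorem GroupWord.eval_eq_zpow_iff {N : Subgroup (FreeGroup α)} [N.Normal] {u v : GroupWord α} :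
    (∃ k : ℤ, v.eval N = u.eval N ^ k) ↔
      ∃ k : ℤ, (FreeGroup.mk v)⁻¹ * FreeGroup.mk u ^ k ∈ N :=
  exists_congr fun _ => QuotientGroup.eq

variable [Primcodable α]

/-- If `N` is recursively enumerable, then so is the positive part of the power problem. -/
theorem IsRecursivelyEnumerable.power {N : Subgroup (FreeGroup α)} [N.Normal]
    (hN : IsRecursivelyEnumerable N) :
    REPred fun p : GroupWord α × GroupWord α => ∃ k : ℤ, p.2.eval N = p.1.eval N ^ k := by
  have h : REPred fun x : (GroupWord α × GroupWord α) × (ℕ × ℕ) =>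
      FreeGroup.mk (FreeGroup.invRev x.1.2 ++ x.1.1.powSub x.2) ∈ N :=
    hN.comp <| GroupWord.computable_append
      (GroupWord.computable_invRev (Computable.snd.comp Computable.fst))
      (GroupWord.computable_powSub (Computable.fst.comp Computable.fst) Computable.snd)
  refine REPred.of_eq (REPred.exists (p := fun (p : GroupWord α × GroupWord α) k =>
    FreeGroup.mk (FreeGroup.invRev p.2 ++ p.1.powSub k) ∈ N) h) fun p => ?_
  rw [GroupWord.eval_eq_zpow_iff]
  simp only [GroupWord.mk_append, GroupWord.mk_invRev, GroupWord.mk_powSub]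
  constructor
  · rintro ⟨k, hk⟩; exact ⟨_, hk⟩
  · rintro ⟨k, hk⟩
    exact ⟨(k.toNat, (-k).toNat), by rwa [Int.toNat_sub_toNat_neg]⟩

end Problems

/-! ### The flow of an element of a free group acting on a set -/

section Flow

open Finsupp

variable {X Ω : Type*} [MulAction (FreeGroup X) Ω]

/-- The permutation of `Ω × ℤ[X × Ω]` that moves the point along the letter `x` and adds the
traversed edge. -/
noncomputable def flowStep (x : X) : Equiv.Perm (Ω × (X × Ω →₀ ℤ)) where
  toFun p := (FreeGroup.of x • p.1, p.2 + single (x, p.1) 1)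
  invFun p := ((FreeGroup.of x)⁻¹ • p.1, p.2 - single (x, (FreeGroup.of x)⁻¹ • p.1) 1)
  left_inv p := by simp
  right_inv p := by simp

/-- The signed number of times that the path read off from `g` starting at `ω` traverses each edge
of the graph with edges `(x, ω)` from `ω` to `x • ω`. -/
noncomputable def flow (g : FreeGroup X) (ω : Ω) : X × Ω →₀ ℤ :=
  (FreeGroup.lift flowStep g (ω, 0)).2

theorem lift_flowStep (g : FreeGroup X) (ω : Ω) (f : X × Ω →₀ ℤ) :
    FreeGroup.lift flowStep g (ω, f) = (g • ω, f + flow g ω) := by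
  suffices h : ∃ φ : Ω → (X × Ω →₀ ℤ), ∀ ω f,
      FreeGroup.lift flowStep g (ω, f) = (g • ω, f + φ ω) by
    obtain ⟨φ, h⟩ := h
    simp [flow, h]
  induction g using FreeGroup.induction_on with
  | C1 => exact ⟨0, by simp⟩
  | of x => exact ⟨fun ω => single (x, ω) 1, fun ω f => by simp [flowStep]⟩
  | inv_of x _ =>
    exact ⟨fun ω => -single (x, (FreeGroup.of x)⁻¹ • ω) 1, fun ω f => by
      rw [map_inv, Equiv.Perm.inv_eq_iff_eq]; simp [flowStep]⟩
  | mul g h hg hh =>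
    obtain ⟨φ, hg⟩ := hg
    obtain ⟨ψ, hh⟩ := hh
    exact ⟨fun ω => ψ ω + φ (h • ω), fun ω f => by simp [hg, hh, mul_smul, add_assoc]⟩

/-- The action is on the left, so paths are read from right to left. -/
theorem flow_mul (g h : FreeGroup X) (ω : Ω) : flow (g * h) ω = flow h ω + flow g (h • ω) := by
  have := lift_flowStep (g * h) ω 0
  rw [map_mul, Equiv.Perm.mul_apply, lift_flowStep, lift_flowStep] at this
  simpa using (congrArg Prod.snd this).symm

@[simp]
theorem flow_one (ω : Ω) : flow (1 : FreeGroup X) ω = 0 := by simp [flow]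

theorem flow_inv (g : FreeGroup X) (ω : Ω) : flow g⁻¹ ω = -flow g (g⁻¹ • ω) := by
  have := flow_mul g g⁻¹ ω
  rw [mul_inv_cancel, flow_one] at this
  exact eq_neg_of_add_eq_zero_left this.symm

@[simp]
theorem flow_of (x : X) (ω : Ω) : flow (FreeGroup.of x) ω = single (x, ω) 1 := by
  simp [flow, flowStep]

/-- Flows are transported by permutations that commute with the action. -/
theorem flow_equiv (e : Ω ≃ Ω) (he : ∀ (g : FreeGroup X) ω, e (g • ω) = g • e ω)
    (g : FreeGroup X) (ω : Ω) (x : X) (ω' : Ω) : flow g (e ω) (x, e ω') = flow g ω (x, ω') := by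
  induction g using FreeGroup.induction_on generalizing ω with
  | C1 => simp
  | of y => classical simp [single_apply]
  | inv_of y _ => classical simp [flow_inv, single_apply, ← he]
  | mul g h hg hh => simp [flow_mul, ← he, hg, hh]

theorem flow_mul_of_smul_eq {h : FreeGroup X} {ω : Ω} (hh : h • ω = ω) (g : FreeGroup X) :
    flow (g * h) ω = flow g ω + flow h ω := by
  rw [flow_mul, hh, add_comm]

theorem flow_inv_of_smul_eq {g : FreeGroup X} {ω : Ω} (hg : g • ω = ω) :
    flow g⁻¹ ω = -flow g ω := by
  rw [flow_inv, inv_smul_eq_iff.2 hg.symm]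

theorem flow_pow_of_smul_eq {g : FreeGroup X} {ω : Ω} (hg : g • ω = ω) (n : ℕ) :
    flow (g ^ n) ω = n • flow g ω := by
  induction n with
  | zero => simp
  | succ n ih => rw [pow_succ, flow_mul_of_smul_eq hg, ih, succ_nsmul]

/-- The path returns along the way it came, so the two legs cancel. -/
theorem flow_conj {k c : FreeGroup X} {ω : Ω} (h : k • c • ω = c • ω) :
    flow (c⁻¹ * k * c) ω = flow k (c • ω) := by
  rw [flow_mul, flow_mul, h, flow_inv, inv_smul_smul]
  abel

/-- The closed paths at `ω` with trivial flow. -/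
def flowKer (ω : Ω) : Subgroup (FreeGroup X) where
  carrier := {g | g • ω = ω ∧ flow g ω = 0}
  one_mem' := by simp
  mul_mem' := by
    rintro g h ⟨hg, hg'⟩ ⟨hh, hh'⟩
    exact ⟨by rw [mul_smul, hh, hg], by rw [flow_mul_of_smul_eq hh, hg', hh', add_zero]⟩
  inv_mem' := by
    rintro g ⟨hg, hg'⟩
    exact ⟨inv_smul_eq_iff.2 hg.symm, by rw [flow_inv_of_smul_eq hg, hg', neg_zero]⟩

/-- On a stabilizer the flow is a homomorphism to an abelian group. -/
theorem commutator_le_flowKer {ω : Ω} {K : Subgroup (FreeGroup X)} (hK : ∀ k ∈ K, k • ω = ω) :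
    ⁅K, K⁆ ≤ flowKer ω := by
  rw [Subgroup.commutator_le]
  intro g hg h hh
  have hg' := hK _ hg
  have hh' := hK _ hh
  have hgi := hK _ (inv_mem hg)
  have hhi := hK _ (inv_mem hh)
  refine ⟨by simp only [commutatorElement_def, mul_smul, hg', hh', hgi, hhi], ?_⟩
  rw [commutatorElement_def, flow_mul_of_smul_eq hhi, flow_mul_of_smul_eq hgi,
    flow_mul_of_smul_eq hh', flow_inv_of_smul_eq hg', flow_inv_of_smul_eq hh']
  abel

theorem smul_coset_one {G : Type*} [Group G] {K : Subgroup G} {g : G} :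
    g • ((1 : G) : G ⧸ K) = (1 : G) ↔ g ∈ K := by
  rw [MulAction.Quotient.smul_coe, eq_comm, QuotientGroup.eq]
  simp

/-- The first homology of the graph of cosets of `K` is the abelianization of `K`. -/
theorem flowKer_coset_le (K : Subgroup (FreeGroup X)) :
    flowKer ((1 : FreeGroup X) : FreeGroup X ⧸ K) ≤ ⁅K, K⁆ := by
  have hs : ∀ (g : FreeGroup X) (ω : FreeGroup X ⧸ K), (g • ω).out⁻¹ * (g * ω.out) ∈ K := by
    intro g ω
    rw [← QuotientGroup.eq, QuotientGroup.out_eq', ← smul_eq_mul, ← MulAction.Quotient.smul_coe,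
      QuotientGroup.out_eq']
  -- Classes of Schreier elements for the transversal `Quotient.out`. They obey the same cocycle
  -- rule as `flow`, hence factor through it by the additive map `Ψ`.
  let σ : FreeGroup X → FreeGroup X ⧸ K → Additive (Abelianization K) := fun g ω =>
    Additive.ofMul (Abelianization.of ⟨(g • ω).out⁻¹ * (g * ω.out), hs g ω⟩)
  have hσ : ∀ g h ω, σ (g * h) ω = σ h ω + σ g (h • ω) := by
    intro g h ω
    rw [add_comm]
    simp only [σ, ← ofMul_mul, ← map_mul]
    congr 2
    ext1
    simp only [mul_smul, Subgroup.coe_mul]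
    group
  let Ψ : (X × (FreeGroup X ⧸ K) →₀ ℤ) →+ Additive (Abelianization K) :=
    liftAddHom fun e => (zmultiplesHom _) (σ (FreeGroup.of e.1) e.2)
  have hΨ : ∀ g ω, Ψ (flow g ω) = σ g ω := by
    intro g
    have h1 : ∀ ω, σ 1 ω = 0 := fun ω => by simpa using hσ 1 1 ω
    have hof : ∀ x ω, Ψ (flow (FreeGroup.of x) ω) = σ (FreeGroup.of x) ω := by
      intro x ω; simp [Ψ]
    induction g using FreeGroup.induction_on with
    | C1 => intro ω; rw [flow_one, map_zero, h1]
    | of x => exact hof x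
    | inv_of x _ =>
      intro ω
      have := hσ (FreeGroup.of x) (FreeGroup.of x)⁻¹ ω
      rw [mul_inv_cancel, h1] at this
      rw [flow_inv, map_neg, hof, eq_neg_of_add_eq_zero_left this.symm]
    | mul g h hg hh => intro ω; rw [flow_mul, map_add, hg, hh, hσ]
  rintro g ⟨hg, hg'⟩
  have hgK := smul_coset_one.1 hg
  have h := hΨ g ((1 : FreeGroup X) : FreeGroup X ⧸ K)
  rw [hg', map_zero] at h
  have ho : ((1 : FreeGroup X) : FreeGroup X ⧸ K).out ∈ K := by
    rw [← smul_coset_one, MulAction.Quotient.smul_coe, smul_eq_mul, mul_one, QuotientGroup.out_eq']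
  -- The representative of the base coset lies in `K`, so conjugating by it has no effect in the
  -- abelianization.
  have h2 : Abelianization.of (⟨g, hgK⟩ : K) = 1 := by
    have h3 : σ g ((1 : FreeGroup X) : FreeGroup X ⧸ K) =
        Additive.ofMul (Abelianization.of ((⟨_, ho⟩ : K)⁻¹ * (⟨g, hgK⟩ * ⟨_, ho⟩))) := by
      simp only [σ]
      congr 2
      ext1
      simp [hg]
    have h4 : Abelianization.of ((⟨_, ho⟩ : K)⁻¹ * (⟨g, hgK⟩ * ⟨_, ho⟩)) = 1 :=
      Additive.ofMul.injective (h3.symm.trans h.symm)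
    rwa [map_mul, map_mul, map_inv, mul_comm (Abelianization.of (⟨g, hgK⟩ : K)),
      inv_mul_cancel_left] at h4
  rw [← Subgroup.map_subtype_commutator]
  exact ⟨⟨g, hgK⟩, by rwa [← Abelianization.ker_of, SetLike.mem_coe, MonoidHom.mem_ker], rfl⟩

/-- If `u` is conjugate to `a ^ j * u` modulo `[K, K]` for all `j`, by elements that normalize `K`,
then `a` lies in `[K, K]`. -/
theorem mem_commutator_of_forall_conj {K : Subgroup (FreeGroup X)} {u a : FreeGroup X}
    (hu : u ∈ K) (ha : a ∈ K)
    (h : ∀ j : ℕ, ∃ c : FreeGroup X, (∀ g, g ∈ K ↔ c⁻¹ * g * c ∈ K) ∧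
      ∃ d ∈ ⁅K, K⁆, c⁻¹ * u * c = d * (a ^ j * u)) : a ∈ ⁅K, K⁆ := by
  set ω : FreeGroup X ⧸ K := ((1 : FreeGroup X) : FreeGroup X ⧸ K) with hω
  have hK : ∀ k ∈ K, k • ω = ω := fun k hk => smul_coset_one.2 hk
  refine flowKer_coset_le K ⟨hK a ha, ?_⟩
  by_contra hne
  obtain ⟨ε, hε⟩ := Finsupp.ne_iff.1 hne
  have hmem : ∀ j : ℕ, flow u ω ε + j * flow a ω ε ∈ Set.range (flow u ω) := by
    intro j
    obtain ⟨c, hc, d, hd, hcd⟩ := h j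
    have hd' := (commutator_le_flowKer hK) hd
    have h1 : flow (c⁻¹ * u * c) ω = flow u ω + j • flow a ω := by
      rw [hcd, flow_mul_of_smul_eq (hK _ (mul_mem (pow_mem ha j) hu)), hd'.2, zero_add,
        flow_mul_of_smul_eq (hK u hu), flow_pow_of_smul_eq (hK a ha), add_comm]
    have hmap : ∀ b : FreeGroup X, (∀ g, g ∈ K → b⁻¹ * g * b ∈ K) → ∀ g₁ g₂ : FreeGroup X,
        (QuotientGroup.leftRel K) g₁ g₂ → (QuotientGroup.leftRel K) (g₁ * b) (g₂ * b) := by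
      intro b hb g₁ g₂ h12
      rw [QuotientGroup.leftRel_apply] at h12 ⊢
      simpa [mul_assoc] using hb _ h12
    have hc' : ∀ g, g ∈ K → c⁻¹⁻¹ * g * c⁻¹ ∈ K := fun g hg => by
      rw [hc]; simpa [mul_assoc] using hg
    -- Since `c` normalizes `K`, right multiplication by `c` is an automorphism of the coset graph;
    -- it takes `ω` to `c • ω`.
    let e : (FreeGroup X ⧸ K) ≃ (FreeGroup X ⧸ K) :=
      { toFun := Quotient.map (· * c) (hmap c fun g => (hc g).1)
        invFun := Quotient.map (· * c⁻¹) (hmap c⁻¹ hc')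
        left_inv := by rintro ⟨g⟩; exact congrArg _ (mul_inv_cancel_right g c)
        right_inv := by rintro ⟨g⟩; exact congrArg _ (inv_mul_cancel_right g c) }
    have he : ∀ (g : FreeGroup X) ω, e (g • ω) = g • e ω := by
      rintro g ⟨g'⟩
      exact congrArg _ (mul_assoc g g' c)
    have hec : c • ω = e ω := congrArg (Quotient.mk _) (by simp)
    have h2 : flow (c⁻¹ * u * c) ω = flow u (e ω) := by
      rw [flow_conj, hec]
      rw [hec, ← he, hK u hu]
    refine ⟨(ε.1, e.symm ε.2), ?_⟩
    rw [← flow_equiv e he, e.apply_symm_apply, ← h2, h1]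
    simp
  have hfin : (Set.range (flow u ω)).Finite := Finsupp.finite_range _
  have hinj : Function.Injective fun j : ℕ => (⟨_, hmem j⟩ : Set.range (flow u ω)) := by
    intro i j hij
    have := congrArg Subtype.val hij
    simpa [show flow a ω ε ≠ 0 from hε] using this
  have := hfin.to_subtype
  exact not_injective_infinite_finite _ hinj

/-- A basic commutator is moved modulo `[K, K]` by every element outside of `K`, if the quotient
by `K` is commutative. -/
theorem exists_commutator_of_notMem [Nontrivial X] {K : Subgroup (FreeGroup X)} [K.Normal]
    (hK : commutator (FreeGroup X) ≤ K) {v : FreeGroup X} (hv : v ∉ K) :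
    ∃ x y : X, ⁅v, ⁅FreeGroup.of x, FreeGroup.of y⁆⁆ ∉ ⁅K, K⁆ := by
  by_contra! hall
  suffices h : ∀ y, FreeGroup.of y ∈ K by
    have : (⊤ : Subgroup (FreeGroup X)) ≤ K := by
      rw [← FreeGroup.closure_range_of, Subgroup.closure_le]
      rintro _ ⟨y, rfl⟩
      exact h y
    exact hv (this trivial)
  intro y
  by_contra hy
  obtain ⟨x, hxy⟩ := exists_ne y
  set ω : FreeGroup X ⧸ K := ((1 : FreeGroup X) : FreeGroup X ⧸ K) with hω
  have htriv : ∀ k ∈ K, ∀ ω : FreeGroup X ⧸ K, k • ω = ω := by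
    rintro k hk ⟨g⟩
    refine (QuotientGroup.eq.2 ?_).symm
    simpa [mul_assoc] using ‹K.Normal›.conj_mem k hk g⁻¹
  set n := ⁅FreeGroup.of x, FreeGroup.of y⁆ with hn
  have hnK : n ∈ K := hK (Subgroup.commutator_mem_commutator trivial trivial)
  have h1 : flow n (v⁻¹ • ω) = flow n ω := by
    have h := (commutator_le_flowKer (fun k hk => htriv k hk ω) (hall x y)).2
    have h' := flow_conj (k := n) (c := v⁻¹) (ω := ω) (htriv n hnK _)
    rw [inv_inv] at h'
    rw [commutatorElement_def, flow_mul_of_smul_eq (htriv _ (inv_mem hnK) ω), h',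
      flow_inv_of_smul_eq (htriv n hnK ω)] at h
    exact add_neg_eq_zero.1 h
  have h2 : ∀ ω : FreeGroup X ⧸ K, FreeGroup.of y • (FreeGroup.of x)⁻¹ • (FreeGroup.of y)⁻¹ • ω =
      (FreeGroup.of x)⁻¹ • ω := by
    intro ω
    rw [eq_inv_smul_iff, ← mul_smul, ← mul_smul, ← mul_smul]
    simpa [hn, commutatorElement_def, mul_assoc] using htriv n hnK ω
  -- This edge is the last one of the square read from `ω`, with value 1 because `y ∉ K`. The square
  -- from `v⁻¹ • ω` could only cross it backwards, giving 0 or -1.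
  have h3 := DFunLike.congr_fun h1 (x, (FreeGroup.of x)⁻¹ • ω)
  have hyω : (FreeGroup.of y)⁻¹ • ω ≠ ω := fun h => hy (inv_mem_iff.1 (smul_coset_one.1 h))
  have hvω : v⁻¹ • ω ≠ ω := fun h => hv (inv_mem_iff.1 (smul_coset_one.1 h))
  classical
  simp only [hn, commutatorElement_def, flow_mul, flow_inv, flow_of, h2, Finsupp.add_apply,
    Finsupp.neg_apply, single_apply, Prod.mk.injEq, hxy.symm, false_and, true_and,
    smul_left_cancel_iff, hyω, hvω, if_false, if_true] at h3
  split_ifs at h3 <;> simp at h3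

end Flow

/-! ### Commutative and noncommutative subgroups of free groups -/

section FreeGroup

variable {α : Type*}

theorem FreeGroup.exists_not_commute (X : Type*) [Nontrivial X] :
    ∃ a b : FreeGroup X, a * b ≠ b * a := by
  classical
  obtain ⟨x, y, hxy⟩ := exists_pair_ne X
  refine ⟨FreeGroup.of x, FreeGroup.of y, fun h => ?_⟩
  have := congrArg (FreeGroup.lift fun z => if z = x then Equiv.swap (0 : Fin 3) 1
    else Equiv.swap 1 2) h
  simp only [_root_.map_mul, FreeGroup.lift_apply_of, if_true, if_neg hxy.symm] at this
  exact absurd this (by decide)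

theorem FreeGroup.exists_forall_mem_zpowers (X : Type*) [Subsingleton X] :
    ∃ z : FreeGroup X, ∀ g, g ∈ Subgroup.zpowers z := by
  have : ∃ z : FreeGroup X, Set.range FreeGroup.of ⊆ ({z} : Set (FreeGroup X)) := by
    rcases isEmpty_or_nonempty X with _ | ⟨⟨x⟩⟩
    · exact ⟨1, by simp⟩
    · exact ⟨FreeGroup.of x, by rintro _ ⟨y, rfl⟩; rw [Subsingleton.elim y x]; rfl⟩
  obtain ⟨z, hz⟩ := this
  refine ⟨z, fun g => ?_⟩
  rw [Subgroup.zpowers_eq_closure]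
  exact Subgroup.closure_mono hz (FreeGroup.closure_range_of X ▸ trivial)

/-- A commutative subgroup of a free group is cyclic. -/
theorem FreeGroup.exists_eq_zpowers (H : Subgroup (FreeGroup α))
    (hH : ∀ a ∈ H, ∀ b ∈ H, a * b = b * a) : ∃ z, H = Subgroup.zpowers z := by
  -- By Nielsen–Schreier `H` is free; commutativity leaves at most one generator.
  let e := IsFreeGroup.mulEquiv H
  rcases subsingleton_or_nontrivial (IsFreeGroup.Generators H) with h | h
  · obtain ⟨z, hz⟩ := FreeGroup.exists_forall_mem_zpowers (IsFreeGroup.Generators H)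
    refine ⟨e z, le_antisymm (fun a ha => ?_) ?_⟩
    · obtain ⟨k, hk⟩ := hz (e.symm ⟨a, ha⟩)
      refine ⟨k, ?_⟩
      have := congrArg (fun b => (e b : FreeGroup α)) hk
      simpa using this
    · rw [Subgroup.zpowers_le]
      exact (e z).2
  · obtain ⟨a, b, hab⟩ := FreeGroup.exists_not_commute (IsFreeGroup.Generators H)
    refine absurd (e.injective ?_) hab
    ext1
    simpa using hH _ (e a).2 _ (e b).2

theorem FreeGroup.exists_common_root {a b : FreeGroup α} (h : a * b = b * a) :
    ∃ z, a ∈ Subgroup.zpowers z ∧ b ∈ Subgroup.zpowers z := by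
  have hc : ∀ x ∈ ({a, b} : Set (FreeGroup α)), ∀ y ∈ ({a, b} : Set (FreeGroup α)),
      x * y = y * x := by
    rintro x (rfl | rfl) y (rfl | rfl) <;> simp [h]
  obtain ⟨z, hz⟩ := FreeGroup.exists_eq_zpowers (Subgroup.closure {a, b}) fun x hx y hy => by
    have := (Subgroup.isMulCommutative_closure hc).is_comm.comm ⟨x, hx⟩ ⟨y, hy⟩
    exact congrArg Subtype.val this
  exact ⟨z, hz ▸ Subgroup.subset_closure (by simp), hz ▸ Subgroup.subset_closure (by simp)⟩

theorem FreeGroup.zpow_injective {z : FreeGroup α} (hz : z ≠ 1) :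
    Function.Injective fun k : ℤ => z ^ k :=
  injective_zpow_iff_not_isOfFinOrder.2 (by rwa [isOfFinOrder_iff_eq_one])

/-- A nontrivial normal subgroup of a noncommutative free group is not commutative. -/
theorem FreeGroup.exists_not_commute_of_normal [Nontrivial α] {N : Subgroup (FreeGroup α)}
    [N.Normal] (hN : N ≠ ⊥) : ∃ a ∈ N, ∃ b ∈ N, a * b ≠ b * a := by
  classical
  by_contra! hcomm
  obtain ⟨z, rfl⟩ := FreeGroup.exists_eq_zpowers N hcomm
  have hz : z ≠ 1 := fun h => hN (by rw [h, Subgroup.zpowers_one_eq_bot])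
  -- Conjugation by a generator sends `z` to `z` or `z⁻¹`, so the square of the generator commutes
  -- with `z` and shares a root with it.
  have key : ∀ x : α, ∃ p q : ℤ, p ≠ 0 ∧ FreeGroup.of x ^ p = z ^ q := by
    intro x
    set f := FreeGroup.of x with hf
    obtain ⟨e, he⟩ := ‹(Subgroup.zpowers z).Normal›.conj_mem z (Subgroup.mem_zpowers z) f
    obtain ⟨e', he'⟩ := ‹(Subgroup.zpowers z).Normal›.conj_mem z (Subgroup.mem_zpowers z) f⁻¹
    simp only [inv_inv] at he he'
    have h1 : z ^ (e * e') = z ^ (1 : ℤ) := by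
      rw [zpow_mul, he, conj_zpow, he', zpow_one]; group
    have h2 : e * e = 1 := by
      rcases Int.isUnit_iff.1 (IsUnit.of_mul_eq_one _ (FreeGroup.zpow_injective hz h1)) with h | h <;>
        simp [h]
    have h3 : (f * f) * z = z * (f * f) := by
      have : f * f * z * f⁻¹ * f⁻¹ = z := by
        calc f * f * z * f⁻¹ * f⁻¹ = f * (f * z * f⁻¹) * f⁻¹ := by group
          _ = z := by rw [← he, ← conj_zpow, ← he, ← zpow_mul, h2, zpow_one]
      nth_rw 2 [← this]
      group
    obtain ⟨t, ⟨i, hi⟩, ⟨j, hj⟩⟩ := FreeGroup.exists_common_root h3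
    simp only at hi hj
    refine ⟨2 * j, i, ?_, ?_⟩
    · rintro h
      obtain rfl : j = 0 := by lia
      exact hz (by rw [← hj, zpow_zero])
    · rw [zpow_mul, zpow_two, ← hi, ← hj, ← zpow_mul, ← zpow_mul, mul_comm]
  obtain ⟨x, y, hxy⟩ := exists_pair_ne α
  obtain ⟨p, q, hp, hpq⟩ := key x
  obtain ⟨p', q', hp', hpq'⟩ := key y
  -- The exponent sum in `x`: a nontrivial power of `y` in `⟨z⟩` forces `χ z` to vanish, a power of
  -- `x` forbids it.
  let χ : FreeGroup α →* Multiplicative ℤ :=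
    FreeGroup.lift fun a => if a = x then Multiplicative.ofAdd 1 else 1
  have h1 := congrArg (fun g => (χ g).toAdd) hpq
  have h2 := congrArg (fun g => (χ g).toAdd) hpq'
  simp [χ, hxy.symm] at h1 h2
  rcases h2 with rfl | h2
  · rw [zpow_zero] at hpq'
    exact hp' (FreeGroup.zpow_injective (FreeGroup.of_ne_one y) (hpq'.trans (zpow_zero _).symm))
  · exact hp (by simpa [χ, h2] using h1)

/-- If `L` is noncommutative, `K ≤ L` and `L / K` is commutative, then every element of `L` that
acts trivially on the image of `[L, L]` in `K / [K, K]` lies in `K`. -/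
theorem FreeGroup.exists_commutator_notMem {L K : Subgroup (FreeGroup α)}
    (hL : ∃ a ∈ L, ∃ b ∈ L, a * b ≠ b * a) (hKL : K ≤ L) (hLK : ⁅L, L⁆ ≤ K)
    {v : FreeGroup α} (hvL : v ∈ L) (hv : v ∉ K) : ∃ n ∈ ⁅L, L⁆, ⁅v, n⁆ ∉ ⁅K, K⁆ := by
  -- Transport to a free basis of `L`, where the preimage of `K` is normal with commutative
  -- quotient.
  let e := IsFreeGroup.mulEquiv L
  let ι : FreeGroup (IsFreeGroup.Generators L) →* FreeGroup α := L.subtype.comp e.toMonoidHom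
  have hιL : ∀ g, ι g ∈ L := fun g => (e g).2
  have hrange : ι.range = L := by
    refine le_antisymm (by rintro _ ⟨g, rfl⟩; exact hιL g) fun a ha => ⟨e.symm ⟨a, ha⟩, ?_⟩
    simp [ι]
  have : Nontrivial (IsFreeGroup.Generators L) := by
    rw [← not_subsingleton_iff_nontrivial]
    intro h
    obtain ⟨a, ha, b, hb, hab⟩ := hL
    obtain ⟨z, hz⟩ := FreeGroup.exists_forall_mem_zpowers (IsFreeGroup.Generators L)
    rw [← hrange] at ha hb
    obtain ⟨a, rfl⟩ := ha
    obtain ⟨b, rfl⟩ := hb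
    obtain ⟨i, rfl⟩ := hz a
    obtain ⟨j, rfl⟩ := hz b
    exact hab (by simp only [← _root_.map_mul, zpow_mul_comm])
  have hcomm : commutator (FreeGroup (IsFreeGroup.Generators L)) ≤ K.comap ι := by
    rw [← Subgroup.map_le_iff_le_comap, commutator_def, Subgroup.map_commutator,
      ← MonoidHom.range_eq_map, hrange]
    exact hLK
  have : (K.comap ι).Normal := Subgroup.Normal.of_commutator_le _ hcomm
  obtain ⟨v, rfl⟩ : v ∈ ι.range := by rwa [hrange]
  obtain ⟨x, y, hxy⟩ := exists_commutator_of_notMem hcomm (v := v) hv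
  refine ⟨ι ⁅FreeGroup.of x, FreeGroup.of y⁆, ?_, fun h => hxy ?_⟩
  · rw [map_commutatorElement]
    exact Subgroup.commutator_mem_commutator (hιL _) (hιL _)
  · have hinj : Function.Injective ι := Subtype.val_injective.comp e.injective
    have hmap : (K.comap ι).map ι = K := by
      rw [Subgroup.map_comap_eq, hrange, inf_eq_right.2 hKL]
    rw [← map_commutatorElement, ← hmap, ← Subgroup.map_commutator] at h
    exact (Subgroup.mem_map_iff_mem hinj).1 h

end FreeGroup

/-! ### Powers modulo `N` and conjugacy modulo `[N, N]` -/

section Conjugacy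

/-- Additively `⁅a, g⁆` is `(1 - g) a`, and `1 - u ^ k` is a multiple of `1 - u` in `ℤ[u, u⁻¹]`. -/
theorem exists_commutatorElement_eq {G : Type*} [Group G] {A : Subgroup G} [A.Normal]
    (hA : ∀ a ∈ A, ∀ b ∈ A, a * b = b * a) (u : G) (k : ℤ) :
    ∀ a ∈ A, ∃ y ∈ A, ⁅a, u ^ k⁆ = ⁅y, u⁆ := by
  have hN : ∀ a ∈ A, ∀ g : G, ⁅a, g⁆ ∈ A := fun a ha g => by
    rw [commutatorElement_def, mul_assoc, mul_assoc, ← mul_assoc g]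
    exact mul_mem ha (‹A.Normal›.conj_mem _ (inv_mem ha) g)
  have hmul : ∀ a ∈ A, ∀ b ∈ A, ∀ g : G, ⁅a * b, g⁆ = ⁅a, g⁆ * ⁅b, g⁆ := by
    intro a ha b hb g
    have h := hA _ (hN b hb g) _ (‹A.Normal›.conj_mem _ (inv_mem ha) g)
    calc ⁅a * b, g⁆ = a * (⁅b, g⁆ * (g * a⁻¹ * g⁻¹)) := by simp only [commutatorElement_def]; group
      _ = ⁅a, g⁆ * ⁅b, g⁆ := by rw [h]; simp only [commutatorElement_def]; group
  have hconj : ∀ (g a b : G), g * ⁅a, b⁆ * g⁻¹ = ⁅g * a * g⁻¹, g * b * g⁻¹⁆ := by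
    intro g a b; simp only [commutatorElement_def]; group
  have hstep : ∀ (k : ℤ) a, ⁅a, u ^ (k + 1)⁆ = ⁅a, u ^ k⁆ * ⁅u ^ k * a * (u ^ k)⁻¹, u⁆ := by
    intro k a
    rw [zpow_add_one]
    simp only [commutatorElement_def]
    group
  induction k with
  | zero => exact fun a _ => ⟨1, one_mem _, by simp [commutatorElement_def]⟩
  | succ k ih =>
    intro a ha
    obtain ⟨y, hy, h⟩ := ih a ha
    have hc := ‹A.Normal›.conj_mem a ha (u ^ (k : ℤ))
    exact ⟨y * _, mul_mem hy hc, by rw [hstep, h, ← hmul _ hy _ hc]⟩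
  | pred k ih =>
    intro a ha
    obtain ⟨y, hy, h⟩ := ih a ha
    have hc := ‹A.Normal›.conj_mem a ha (u ^ (-(k : ℤ) - 1))
    refine ⟨y * _, mul_mem hy (inv_mem hc), ?_⟩
    have := hstep (-(k : ℤ) - 1) a
    rw [sub_add_cancel, h] at this
    rw [hmul _ hy _ (inv_mem hc), this, mul_assoc, ← hmul _ hc _ (inv_mem hc)]
    simp [commutatorElement_def]

variable {α : Type*} {N : Subgroup (FreeGroup α)} [N.Normal]

/-- As `v` and `u ^ k` act alike on `N / N'`, `⁅n, v⁆ = ⁅n, u ^ k⁆ = ⁅y, u⁆` there, and `⁅y, u⁆ * u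
= y * u * y⁻¹`. -/
theorem isConj_commutator_mul {u v : FreeGroup α} {k : ℤ} (h : v⁻¹ * u ^ k ∈ N)
    {n : FreeGroup α} (hn : n ∈ N) :
    IsConj (QuotientGroup.mk (⁅n, v⁆ * u) : FreeGroup α ⧸ ⁅N, N⁆) (QuotientGroup.mk u) := by
  let π := QuotientGroup.mk' ⁅N, N⁆
  have hcomm : ∀ a ∈ N.map π, ∀ b ∈ N.map π, a * b = b * a := by
    rintro _ ⟨a, ha, rfl⟩ _ ⟨b, hb, rfl⟩
    rw [← commutatorElement_eq_one_iff_mul_comm, ← map_commutatorElement]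
    exact (QuotientGroup.eq_one_iff _).2 (Subgroup.commutator_mem_commutator ha hb)
  have hnormal : (N.map π).Normal := ‹N.Normal›.map π (QuotientGroup.mk'_surjective _)
  have hnπ : π n ∈ N.map π := ⟨n, hn, rfl⟩
  obtain ⟨y, -, hy⟩ := exists_commutatorElement_eq hcomm (π u) k (π n) hnπ
  have h1 : ⁅π n, π v⁆ = ⁅π n, π u ^ k⁆ := by
    have hm : π (u ^ k * v⁻¹) ∈ N.map π :=
      ⟨_, (Subgroup.Normal.mem_comm_iff ‹_›).1 h, rfl⟩
    have hm' := hcomm _ (hnormal.conj_mem _ (inv_mem hnπ) (π v)) _ hm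
    have hv : π u ^ k = π (u ^ k * v⁻¹) * π v := by simp
    rw [hv, commutatorElement_def, commutatorElement_def]
    calc π n * π v * (π n)⁻¹ * (π v)⁻¹
        = π n * (π v * (π n)⁻¹ * (π v)⁻¹ * π (u ^ k * v⁻¹)) * (π (u ^ k * v⁻¹))⁻¹ := by group
      _ = _ := by rw [hm']; group
  change IsConj (π (⁅n, v⁆ * u)) (π u)
  rw [map_mul, map_commutatorElement, h1, hy]
  refine IsConj.symm (isConj_iff.2 ⟨y, ?_⟩)
  rw [commutatorElement_def]; group

theorem commutator_commutator_mem {u v : FreeGroup α} {k : ℤ} (h : v⁻¹ * u ^ k ∈ N)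
    {n : FreeGroup α} (hn : n ∈ N) : ⁅⁅u, v⁆, n⁆ ∈ ⁅N, N⁆ := by
  refine Subgroup.commutator_mem_commutator ?_ hn
  rw [← QuotientGroup.eq_one_iff]
  change QuotientGroup.mk' N ⁅u, v⁆ = 1
  have hv : QuotientGroup.mk' N v = QuotientGroup.mk' N u ^ k := by
    rw [← map_zpow]; exact QuotientGroup.eq.2 h
  rw [map_commutatorElement, hv, commutatorElement_eq_one_iff_mul_comm]
  exact (Commute.refl _).zpow_right k

/-- A word that is not a power of `u` modulo `N` is detected by conjugacy modulo `[N, N]`. -/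
theorem exists_not_isConj [Nontrivial α] (hN : N ≠ ⊥) {u v : FreeGroup α}
    (h : ∀ k : ℤ, v⁻¹ * u ^ k ∉ N) :
    ∃ n ∈ N, ⁅⁅u, v⁆, n⁆ ∉ ⁅N, N⁆ ∨
      ¬ IsConj (QuotientGroup.mk (⁅n, v⁆ * u) : FreeGroup α ⧸ ⁅N, N⁆) (QuotientGroup.mk u) := by
  let π := QuotientGroup.mk' N
  have hmem : ∀ g, π g = 1 ↔ g ∈ N := fun g => QuotientGroup.eq_one_iff g
  obtain ⟨a, ha, b, hb, hab⟩ := FreeGroup.exists_not_commute_of_normal hN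
  have hle : ∀ S : Subgroup (FreeGroup α ⧸ N), N ≤ S.comap π := fun S g hg => by
    rw [Subgroup.mem_comap, (hmem g).2 hg]; exact one_mem _
  by_cases huv : ⁅u, v⁆ ∈ N
  swap
  -- `L / N` is cyclic, so the square argument applies with `K = N`.
  · let L := (Subgroup.zpowers (π ⁅u, v⁆)).comap π
    have hLN : ⁅L, L⁆ ≤ N := by
      rw [Subgroup.commutator_le]
      rintro g ⟨i, hi⟩ g' ⟨j, hj⟩
      rw [← hmem, map_commutatorElement, ← hi, ← hj, commutatorElement_eq_one_iff_mul_comm]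
      exact zpow_mul_comm _ _ _
    obtain ⟨n, hn, h⟩ := FreeGroup.exists_commutator_notMem (L := L) (K := N)
      ⟨a, hle _ ha, b, hle _ hb, hab⟩ (hle _) hLN (v := ⁅u, v⁆) (Subgroup.mem_zpowers _) huv
    exact ⟨n, hLN hn, .inl h⟩
  · let K := (Subgroup.zpowers (π u)).comap π
    let L := (Subgroup.closure {π u, π v}).comap π
    have hcomm : π u * π v = π v * π u := by
      rw [← commutatorElement_eq_one_iff_mul_comm, ← map_commutatorElement, hmem]; exact huv
    have hc : ∀ x ∈ ({π u, π v} : Set (FreeGroup α ⧸ N)), ∀ y ∈ ({π u, π v} : Set _),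
        x * y = y * x := by
      rintro x (rfl | rfl) y (rfl | rfl) <;> simp [hcomm]
    have hLN : ⁅L, L⁆ ≤ N := by
      rw [Subgroup.commutator_le]
      intro g hg g' hg'
      rw [← hmem, map_commutatorElement, commutatorElement_eq_one_iff_mul_comm]
      exact congrArg Subtype.val
        ((Subgroup.isMulCommutative_closure hc).is_comm.comm ⟨_, hg⟩ ⟨_, hg'⟩)
    have hKL : K ≤ L := Subgroup.comap_mono <| (Subgroup.zpowers_le).2 <|
      Subgroup.subset_closure (by simp)
    have hvL : v ∈ L := Subgroup.subset_closure (show π v ∈ ({π u, π v} : Set _) by simp)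
    have hvK : v ∉ K := by
      rintro ⟨k, hk⟩
      refine h k ((hmem _).1 ?_)
      simp only at hk
      rw [map_mul, map_inv, map_zpow, hk, inv_mul_cancel]
    obtain ⟨n, hn, hn'⟩ := FreeGroup.exists_commutator_notMem
      ⟨a, hle _ ha, b, hle _ hb, hab⟩ hKL (hLN.trans (hle _)) hvL hvK
    have hnN : n ∈ N := hLN hn
    by_contra! hcon
    refine hn' ?_
    rw [← commutatorElement_inv]
    refine inv_mem ?_
    have hu : u ∈ K := Subgroup.mem_zpowers _
    have hcN : ∀ m ∈ N, v * m * v⁻¹ ∈ N := fun m hm => ‹N.Normal›.conj_mem m hm v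
    have hnvN : ⁅n, v⁆ ∈ N := by
      rw [commutatorElement_def, mul_assoc, mul_assoc, ← mul_assoc v]
      exact mul_mem hnN (hcN _ (inv_mem hnN))
    have hNK : ⁅N, N⁆ ≤ ⁅K, K⁆ := Subgroup.commutator_mono (hle _) (hle _)
    refine mem_commutator_of_forall_conj hu (hle _ hnvN) fun j => ?_
    obtain ⟨c, hc⟩ := isConj_iff.1 (hcon _ (pow_mem hnN j)).2.symm
    obtain ⟨c, rfl⟩ := QuotientGroup.mk_surjective c
    -- `n` and `v * n⁻¹ * v⁻¹` both lie in `N`, hence commute modulo `N'`.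
    have hpow : (QuotientGroup.mk ⁅n ^ j, v⁆ : FreeGroup α ⧸ ⁅N, N⁆) = QuotientGroup.mk (⁅n, v⁆ ^ j) := by
      have hw := hcN _ (inv_mem hnN)
      have hcm : Commute (QuotientGroup.mk' ⁅N, N⁆ n) (QuotientGroup.mk' ⁅N, N⁆ (v * n⁻¹ * v⁻¹)) := by
        rw [← commutatorElement_eq_one_iff_commute, ← map_commutatorElement]
        exact (QuotientGroup.eq_one_iff _).2 (Subgroup.commutator_mem_commutator hnN hw)
      have := hcm.mul_pow j
      simp only [← map_mul, ← map_pow, conj_pow] at this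
      rw [inv_pow, ← mul_assoc, ← mul_assoc, ← mul_assoc, ← mul_assoc] at this
      exact this.symm
    have hcu : c * u * c⁻¹ * (⁅n, v⁆ ^ j * u)⁻¹ ∈ ⁅N, N⁆ := by
      rw [← QuotientGroup.eq_one_iff, QuotientGroup.mk_mul, QuotientGroup.mk_inv,
        QuotientGroup.mk_mul _ (⁅n, v⁆ ^ j), ← hpow, mul_inv_eq_one]
      exact hc
    refine ⟨c⁻¹, fun g => ?_, _, hNK hcu, by group⟩
    -- Modulo `N` the conjugator centralizes `u`, so it normalizes `K`.
    have hcu' : π c * π u * (π c)⁻¹ = π u := by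
      have h1 := (hmem _).2 (Subgroup.commutator_le_left N N hcu)
      have h2 := (hmem _).2 hnvN
      simpa only [map_mul, map_inv, map_pow, h2, one_pow, one_mul, mul_inv_eq_one] using h1
    simp only [K, Subgroup.mem_comap, Subgroup.mem_zpowers_iff, inv_inv, map_mul, map_inv]
    refine exists_congr fun k => ?_
    have hk : π u ^ k = π c * π u ^ k * (π c)⁻¹ := by rw [← conj_zpow, hcu']
    constructor <;> intro h
    · rw [← h, ← hk]
    · rw [hk] at h
      exact mul_left_cancel (mul_right_cancel h)

end Conjugacy

/-! ### The power problem -/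

section PowerProblem

variable {α : Type*} [Primcodable α] {N : Subgroup (FreeGroup α)} [N.Normal]

theorem PowerProblemDecidable.of_compl_re (hN : IsRecursivelyEnumerable N)
    (h : REPred fun p : GroupWord α × GroupWord α =>
      ∀ k : ℤ, (FreeGroup.mk p.2)⁻¹ * FreeGroup.mk p.1 ^ k ∉ N) : PowerProblemDecidable N :=
  ComputablePred.computable_iff_re_compl_re'.2 ⟨hN.power, h.of_eq fun p => by
    rw [GroupWord.eval_eq_zpow_iff, not_exists]⟩

/-- Decidability of the conjugacy problem implies decidability of the word problem. -/
theorem ConjugacyProblemDecidable.mem {M : Subgroup (FreeGroup α)} [M.Normal]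
    (h : ConjugacyProblemDecidable M) :
    ComputablePred fun w : GroupWord α => FreeGroup.mk w ∈ M := by
  obtain ⟨f, hf, hp⟩ := ComputablePred.computable_iff.1 h
  refine ComputablePred.computable_iff.2
    ⟨fun w => f (w, []), hf.comp (Computable.pair Computable.id (Computable.const [])), ?_⟩
  ext w
  rw [← congrFun hp (w, [])]
  change _ ↔ IsConj (QuotientGroup.mk (FreeGroup.mk w) : FreeGroup α ⧸ M) (QuotientGroup.mk 1)
  rw [QuotientGroup.mk_one, isConj_one_left, QuotientGroup.eq_one_iff]

theorem ConjugacyProblemDecidable.not_isConj_re {M : Subgroup (FreeGroup α)} [M.Normal]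
    (h : ConjugacyProblemDecidable M) {β : Type*} [Primcodable β] {f g : β → GroupWord α}
    (hf : Computable f) (hg : Computable g) :
    REPred fun b => ¬ IsConj (QuotientGroup.mk (FreeGroup.mk (f b)) : FreeGroup α ⧸ M)
      (QuotientGroup.mk (FreeGroup.mk (g b))) :=
  h.not.to_re.comp (Computable.pair hf hg)

/-- Membership in each coset is r.e., and non-powers form a finite list of pairs of cosets. -/
theorem powerProblemDecidable_of_finite [Finite (FreeGroup α ⧸ N)]
    (hN : IsRecursivelyEnumerable N) : PowerProblemDecidable N := by
  refine PowerProblemDecidable.of_compl_re hN ?_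
  have hex : ∀ q : FreeGroup α ⧸ N, ∃ w : GroupWord α, QuotientGroup.mk (FreeGroup.mk w) = q := by
    intro q
    obtain ⟨g, rfl⟩ := QuotientGroup.mk_surjective q
    obtain ⟨w, rfl⟩ : ∃ w, FreeGroup.mk w = g := Quot.exists_rep g
    exact ⟨w, rfl⟩
  choose rep hrep using hex
  have key : ∀ q : FreeGroup α ⧸ N, ∀ w : GroupWord α,
      FreeGroup.mk (FreeGroup.invRev (rep q) ++ w) ∈ N ↔ q = QuotientGroup.mk (FreeGroup.mk w) := by
    intro q w
    conv_rhs => rw [← hrep q]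
    rw [QuotientGroup.eq]
    rfl
  have hfin : REPred fun p : GroupWord α × GroupWord α =>
      ∃ q : {q : (FreeGroup α ⧸ N) × (FreeGroup α ⧸ N) // ∀ k : ℤ, q.2 ≠ q.1 ^ k},
        FreeGroup.mk (FreeGroup.invRev (rep q.1.1) ++ p.1) ∈ N ∧
          FreeGroup.mk (FreeGroup.invRev (rep q.1.2) ++ p.2) ∈ N := by
    refine REPred.exists_of_finite fun q => REPred.and ?_ ?_
    · exact hN.comp (GroupWord.computable_append (Computable.const _) Computable.fst)
    · exact hN.comp (GroupWord.computable_append (Computable.const _) Computable.snd)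
  refine hfin.of_eq fun p => ?_
  simp only [key]
  have hmem : ∀ k : ℤ, (FreeGroup.mk p.2)⁻¹ * FreeGroup.mk p.1 ^ k ∈ N ↔
      (QuotientGroup.mk (FreeGroup.mk p.2) : FreeGroup α ⧸ N) =
        QuotientGroup.mk (FreeGroup.mk p.1) ^ k := fun k => QuotientGroup.eq.symm
  simp only [hmem]
  constructor
  · rintro ⟨⟨⟨q, q'⟩, hq⟩, rfl, rfl⟩
    exact hq
  · exact fun h => ⟨⟨(_, _), h⟩, rfl, rfl⟩

theorem FreeGroup.finite_quotient_of_subsingleton {X : Type*} [Subsingleton X]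
    {M : Subgroup (FreeGroup X)} [M.Normal] (hM : M ≠ ⊥) : Finite (FreeGroup X ⧸ M) := by
  obtain ⟨z, hz⟩ := FreeGroup.exists_forall_mem_zpowers X
  obtain ⟨m, hm, hm1⟩ := M.bot_or_exists_ne_one.resolve_left hM
  obtain ⟨k, rfl⟩ := hz m
  have hk : k ≠ 0 := by
    rintro rfl
    exact hm1 (zpow_zero z)
  have hfin : IsOfFinOrder (QuotientGroup.mk z : FreeGroup X ⧸ M) :=
    isOfFinOrder_iff_zpow_eq_one.2 ⟨k, hk, (QuotientGroup.eq_one_iff _).2 hm⟩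
  have := hfin.finite_zpowers
  refine Set.finite_univ_iff.1 (Set.Finite.subset (s := (Subgroup.zpowers
    (QuotientGroup.mk z : FreeGroup X ⧸ M) : Set _)) this ?_)
  rintro q -
  obtain ⟨g, rfl⟩ := QuotientGroup.mk_surjective q
  obtain ⟨i, rfl⟩ := hz g
  exact ⟨i, rfl⟩

/-- Commuting elements share a root of infinite order, so being a power becomes divisibility of
exponents. Inverting `z` makes `a` nonnegative; `a = 0` is covered since `m % 0 = m`. -/
theorem FreeGroup.forall_zpow_ne_iff {X : Type*} {u v : FreeGroup X} :
    (∀ k : ℤ, v⁻¹ * u ^ k ≠ 1) ↔ ⁅u, v⁆ ≠ 1 ∨ ∃ (z : FreeGroup X) (a : ℕ) (b : ℕ × ℕ),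
      z ≠ 1 ∧ u = z ^ a ∧ v = z ^ ((b.1 : ℤ) - b.2) ∧ b.2 % a ≠ b.1 % a := by
  have hdvd : ∀ (a : ℕ) (b : ℕ × ℕ), b.2 % a = b.1 % a ↔ (a : ℤ) ∣ (b.1 : ℤ) - b.2 :=
    fun a b => Nat.modEq_iff_dvd
  simp only [ne_eq, inv_mul_eq_one, commutatorElement_eq_one_iff_mul_comm, hdvd]
  constructor
  · intro h
    refine or_iff_not_imp_left.2 fun hc => ?_
    obtain ⟨z, ⟨i, rfl⟩, ⟨j, rfl⟩⟩ := FreeGroup.exists_common_root (not_not.1 hc)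
    have hij : ¬ i ∣ j := by
      rintro ⟨k, rfl⟩
      exact h k (zpow_mul z i k)
    have hz : z ≠ 1 := by
      rintro rfl
      exact h 0 (by simp)
    rcases le_total 0 i with hi | hi
    · refine ⟨z, i.toNat, (j.toNat, (-j).toNat), hz, ?_, ?_, ?_⟩
      · rw [← zpow_natCast, Int.toNat_of_nonneg hi]
      · rw [Int.toNat_sub_toNat_neg]
      · rwa [Int.toNat_sub_toNat_neg, Int.toNat_of_nonneg hi]
    · refine ⟨z⁻¹, (-i).toNat, ((-j).toNat, (- -j).toNat), inv_ne_one.2 hz, ?_, ?_, ?_⟩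
      · rw [← zpow_natCast, Int.toNat_of_nonneg (by lia), inv_zpow', neg_neg]
      · rw [Int.toNat_sub_toNat_neg, inv_zpow', neg_neg]
      · rwa [Int.toNat_sub_toNat_neg, Int.toNat_of_nonneg (by lia), neg_dvd, dvd_neg]
  · rintro (h | ⟨z, a, b, hz, rfl, rfl, h⟩) k hk
    · exact h (by rw [hk]; exact ((Commute.refl u).zpow_right k).eq)
    · rw [← zpow_natCast, ← zpow_mul] at hk
      exact h ⟨k, FreeGroup.zpow_injective hz hk⟩

theorem powerProblemDecidable_bot (hCP : ConjugacyProblemDecidable (⊥ : Subgroup (FreeGroup α))) :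
    PowerProblemDecidable (⊥ : Subgroup (FreeGroup α)) := by
  have hre : REPred fun w : GroupWord α => FreeGroup.mk w = 1 := hCP.mem.to_re
  have hne : REPred fun w : GroupWord α => FreeGroup.mk w ≠ 1 := hCP.mem.not.to_re
  refine PowerProblemDecidable.of_compl_re hre ?_
  have hroot : REPred fun x : (GroupWord α × GroupWord α) × (GroupWord α × ℕ × ℕ × ℕ) =>
      FreeGroup.mk x.2.1 ≠ 1 ∧
      FreeGroup.mk (FreeGroup.invRev x.1.1 ++ x.2.1.powSub (x.2.2.1, 0)) = 1 ∧
      FreeGroup.mk (FreeGroup.invRev x.1.2 ++ x.2.1.powSub x.2.2.2) = 1 ∧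
      x.2.2.2.2 % x.2.2.1 ≠ x.2.2.2.1 % x.2.2.1 := by
    have hz : Computable fun x : (GroupWord α × GroupWord α) × (GroupWord α × ℕ × ℕ × ℕ) =>
      x.2.1 := Computable.fst.comp Computable.snd
    have hn : Primrec fun x : (GroupWord α × GroupWord α) × (GroupWord α × ℕ × ℕ × ℕ) =>
      x.2.2 := Primrec.snd.comp Primrec.snd
    have ha := Primrec.fst.comp hn
    have hb := Primrec.snd.comp hn
    refine (hne.comp hz).and (REPred.and (hre.comp ?_) (REPred.and (hre.comp ?_) ?_))
    · exact GroupWord.computable_append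
        (GroupWord.computable_invRev (Computable.fst.comp Computable.fst))
        (GroupWord.computable_powSub hz (Computable.pair ha.to_comp (Computable.const 0)))
    · exact GroupWord.computable_append
        (GroupWord.computable_invRev (Computable.snd.comp Computable.fst))
        (GroupWord.computable_powSub hz hb.to_comp)
    · exact (Primrec.eq.comp (Primrec.nat_mod.comp (Primrec.snd.comp hb) ha)
        (Primrec.nat_mod.comp (Primrec.fst.comp hb) ha)).not.computablePred.to_re
  have hcomm : REPred fun p : GroupWord α × GroupWord α => FreeGroup.mk (p.1.comm p.2) ≠ 1 :=
    hne.comp (GroupWord.computable_comm Computable.fst Computable.snd)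
  refine (hcomm.or (REPred.exists (p := fun (p : GroupWord α × GroupWord α)
    (y : GroupWord α × ℕ × ℕ × ℕ) => FreeGroup.mk y.1 ≠ 1 ∧
      FreeGroup.mk (FreeGroup.invRev p.1 ++ y.1.powSub (y.2.1, 0)) = 1 ∧
      FreeGroup.mk (FreeGroup.invRev p.2 ++ y.1.powSub y.2.2) = 1 ∧
      y.2.2.2 % y.2.1 ≠ y.2.2.1 % y.2.1) hroot)).of_eq fun p => ?_
  simp only [Subgroup.mem_bot, ← ne_eq]
  rw [FreeGroup.forall_zpow_ne_iff, GroupWord.mk_comm]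
  simp only [GroupWord.mk_append, GroupWord.mk_invRev, GroupWord.mk_powSub, inv_mul_eq_one,
    Nat.cast_zero, sub_zero, zpow_natCast]
  refine or_congr_right ⟨?_, ?_⟩
  · rintro ⟨⟨z, a, b⟩, h⟩
    exact ⟨_, a, b, h⟩
  · rintro ⟨z, a, b, h⟩
    obtain ⟨z, rfl⟩ : ∃ w, FreeGroup.mk w = z := Quot.exists_rep z
    exact ⟨⟨z, a, b⟩, h⟩

theorem powerProblemDecidable_of_nontrivial [Nontrivial α] (hbot : N ≠ ⊥)
    (hN : IsRecursivelyEnumerable N) (hCP : ConjugacyProblemDecidable ⁅N, N⁆) :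
    PowerProblemDecidable N := by
  refine PowerProblemDecidable.of_compl_re hN ?_
  have hu : Computable fun x : (GroupWord α × GroupWord α) × GroupWord α => x.1.1 :=
    Computable.fst.comp Computable.fst
  have hv : Computable fun x : (GroupWord α × GroupWord α) × GroupWord α => x.1.2 :=
    Computable.snd.comp Computable.fst
  have h : REPred fun x : (GroupWord α × GroupWord α) × GroupWord α =>
      FreeGroup.mk x.2 ∈ N ∧ (FreeGroup.mk ((x.1.1.comm x.1.2).comm x.2) ∉ ⁅N, N⁆ ∨
        ¬ IsConj (QuotientGroup.mk (FreeGroup.mk (x.2.comm x.1.2 ++ x.1.1)) :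
          FreeGroup α ⧸ ⁅N, N⁆) (QuotientGroup.mk (FreeGroup.mk x.1.1))) := by
    refine (hN.comp Computable.snd).and (REPred.or ?_ ?_)
    · exact hCP.mem.not.to_re.comp
        (GroupWord.computable_comm (GroupWord.computable_comm hu hv) Computable.snd)
    · exact hCP.not_isConj_re (GroupWord.computable_append
        (GroupWord.computable_comm Computable.snd hv) hu) hu
  refine (REPred.exists (p := fun (p : GroupWord α × GroupWord α) (n : GroupWord α) =>
    FreeGroup.mk n ∈ N ∧ (FreeGroup.mk ((p.1.comm p.2).comm n) ∉ ⁅N, N⁆ ∨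
      ¬ IsConj (QuotientGroup.mk (FreeGroup.mk (n.comm p.2 ++ p.1)) :
        FreeGroup α ⧸ ⁅N, N⁆) (QuotientGroup.mk (FreeGroup.mk p.1)))) h).of_eq fun p => ?_
  simp only [GroupWord.mk_append, GroupWord.mk_comm]
  constructor
  · rintro ⟨n, hn, h | h⟩ k hk
    · exact h (commutator_commutator_mem hk hn)
    · exact h (isConj_commutator_mul hk hn)
  · intro hk
    obtain ⟨n, h⟩ := exists_not_isConj hbot hk
    obtain ⟨n, rfl⟩ : ∃ w, FreeGroup.mk w = n := Quot.exists_rep n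
    exact ⟨n, h⟩

end PowerProblem

theorem mainTheorem3 {α : Type*} [Primcodable α] (N : Subgroup (FreeGroup α)) [N.Normal]
    (hN : IsRecursivelyEnumerable N) (hCP : ConjugacyProblemDecidable ⁅N, N⁆) :
    PowerProblemDecidable N := by
  rcases eq_or_ne N ⊥ with rfl | hbot
  · refine powerProblemDecidable_bot ?_
    -- Generalizing `M` lets the `Normal` instance follow the substitution.
    have h : ∀ (M : Subgroup (FreeGroup α)) [M.Normal], M = ⊥ →
        ConjugacyProblemDecidable M → ConjugacyProblemDecidable (⊥ : Subgroup (FreeGroup α)) := by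
      rintro M _ rfl h
      exact h
    exact h _ (Subgroup.commutator_bot_left _) hCP
  · rcases subsingleton_or_nontrivial α with _ | _
    · have := FreeGroup.finite_quotient_of_subsingleton hbot
      exact powerProblemDecidable_of_finite hN
    · exact powerProblemDecidable_of_nontrivial hbot hN hCP
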